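/- **Setting.** The cake is $[0,1]$ and is divided between $n$ agents. A valuation $V$ assigns to every interval $[a,b]\subseteq[0,1]$ a value $V(a,b)\ge 0$, with $V(0,1)=1$, $V(a,b)+V(b,c)=V(a,c)$ for $a\le b\le c$, and such that for every $[a,b]$ and $\lambda\in[0,1]$ there is $c\in[a,b]$ with $V(a,c)=\lambda V(a,b)$; it is extended additively to finite unions of intervals that overlap at most in end points. If agent $j$ receives the piece $X_j$, then $\mathrm{envy}(i,j)=\max(V_i(X_j)-V_i(X_i),0)$. An *extended BC protocol* is a finite tree with three kinds of nodes. Cut node (one child): a given agent makes a cut anywhere in $[x,y]$, where $x,y$ are given points among $0$, $1$ and the cuts made earlier on the path; there may be other cuts between $x$ and $y$. Choose node (at least one child): a given agent chooses the child with which the protocol continues. Leaf: a list of triples $(i,x,y)$, each of which gives the interval $[x,y]$ between two such points to agent $i$. It is required that in every execution $x\le y$ for all intervals used, and that the intervals given away at the leaf overlap at most in end points and cover $[0,1]$. A *GCC protocol* is a finite tree with the following nodes. Cut node (at most one child): a given agent picks an interval from a given nonempty finite set $S$ of intervals and makes a cut anywhere in it. Choose node (at most one child): a given agent picks an interval from such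 a set $S$, and this interval is allocated to that agent. If-else node: the protocol continues with one of several children, as determined by conditions on the order of the points and on which pieces were picked in the previous cut and choose actions. The intervals in $S$ have end points among $0$, $1$ and the earlier cuts, are correctly ordered, and overlap at most in end points; in the more permissive interpretation, which is used here, they may contain earlier cuts. It is required that in every execution the allocated intervals overlap at most in end points and cover $[0,1]$ at the end. All agents have perfect information. Two protocols for $n$ agents are *strongly envy-equivalent* if for every agent $i$ with any valuation, every set $S$ of agents not containing $i$, and all $M_j\in[0,1]$ ($j\in S$): agent $i$ has a strategy in the first protocol that guarantees $\mathrm{envy}(i,j)\le M_j$ for all $j\in S$ simultaneously, whatever the other agents do, if and only if agent $i$ has such a strategy in the second protocol. **Statement.** There is an algorithm, running in polynomial time in the length of the input (trees being written as strings in prefix notation over a finite alphabet, with numbers in binary), that converts every extended BC protocol into a GCC protocol, in the more permissive interpretation, for the same agents that is strongly envy-equivalent to it. -/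

import Mathlib

namespace CakeCutting

/-! ## Valuations, allocations and envy -/

/-- A valuation function on the cake `[0, 1]`: `V.val a b` is the value of the interval `[a, b]`.
Only arguments with `0 ≤ a ≤ b ≤ 1` matter. -/
structure Valuation where
  val : ℝ → ℝ → ℝ
  normalized : val 0 1 = 1
  additive : ∀ a b c : ℝ, 0 ≤ a → a ≤ b → b ≤ c → c ≤ 1 → val a b + val b c = val a c
  divisible : ∀ a b t : ℝ, 0 ≤ a → a ≤ b → b ≤ 1 → 0 ≤ t → t ≤ 1 →
    ∃ c ∈ Set.Icc a b, val a c = t * val a b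
  nonneg : ∀ a b : ℝ, 0 ≤ a → a ≤ b → b ≤ 1 → 0 ≤ val a b

/-- An allocated interval `[lo, hi]` together with the agent who gets it. -/
structure Share where
  agent : ℕ
  lo : ℝ
  hi : ℝ

/-- The list of all intervals that have been given to agents. The piece of cake of an agent is the
union of the intervals of that agent. -/
abbrev Allocation := List Share

/-- `A` divides the whole cake between the agents `0, …, n - 1`: the intervals overlap at most in
end points and cover `[0, 1]`. -/
def Allocation.IsDivision (n : ℕ) (A : Allocation) : Prop :=
  (∀ s ∈ A, s.agent < n ∧ s.lo ≤ s.hi) ∧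
  A.Pairwise (fun s t => Disjoint (Set.Ioo s.lo s.hi) (Set.Ioo t.lo t.hi)) ∧
  (⋃ s ∈ A, Set.Icc s.lo s.hi) = Set.Icc 0 1

/-- The value, with respect to `V`, of the piece of agent `j` in the allocation `A`. -/
noncomputable def Allocation.value (V : Valuation) (A : Allocation) (j : ℕ) : ℝ :=
  ((A.filter (fun s => s.agent = j)).map (fun s => V.val s.lo s.hi)).sum

/-- The envy of agent `i`, whose valuation is `V`, towards agent `j`. -/
noncomputable def Allocation.envy (V : Valuation) (A : Allocation) (i j : ℕ) : ℝ :=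
  max (A.value V j - A.value V i) 0

/-! ## The game played by the agents; strong envy-equivalence -/

/-- The (perfect information) game tree of a cake-cutting protocol: a position is either final, with
an allocation, or some agent picks one of the moves in `M`. -/
inductive Game : Type 1
  | finish (A : Allocation) : Game
  | move (agent : ℕ) (M : Type) (next : M → Game) : Game

/-- A strategy of agent `i`: a move for every position of the game that is controlled by `i`. -/
def Game.Strategy (i : ℕ) : Game → Type
  | .finish _ => Unit
  | .move agent M next => (agent = i → M) × ((m : M) → Game.Strategy i (next m))

/-- The allocation that results when every agent `i` plays the strategy `s i`. -/
def Game.outcome : (g : Game) → ((i : ℕ) → g.Strategy i) → Allocation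
  | .finish A, _ => A
  | .move agent _ next, s =>
    Game.outcome (next ((s agent).1 rfl)) (fun i => (s i).2 ((s agent).1 rfl))

/-- In the game `g`, agent `i` with valuation `V` can guarantee the simultaneous bounds
`envy(i, j) ≤ b j` for all `j ∈ S`, whatever strategies the other agents use. -/
def Game.CanGuarantee (g : Game) (V : Valuation) (i : ℕ) (S : Finset ℕ) (b : ℕ → ℝ) : Prop :=
  ∃ σ : g.Strategy i, ∀ s : (j : ℕ) → g.Strategy j, s i = σ →
    ∀ j ∈ S, (g.outcome s).envy V i j ≤ b j

/-- Strong envy-equivalence of two protocols for the agents `0, …, n - 1`, given by their games. -/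
def StronglyEnvyEquivalent (n : ℕ) (g g' : Game) : Prop :=
  ∀ (V : Valuation) (i : ℕ), i < n →
  ∀ S : Finset ℕ, (∀ j ∈ S, j < n) → i ∉ S →
  ∀ b : ℕ → ℝ, (∀ j ∈ S, b j ∈ Set.Icc (0 : ℝ) 1) →
    (g.CanGuarantee V i S b ↔ g'.CanGuarantee V i S b)

/-! ## Points of the cake -/

/-- A point that a protocol can refer to: an end point of the cake, or the earlier cut that was
named `z`. (If a name is given to a second cut, it then refers to that one.) -/
inductive Point
  | left
  | right
  | cut (z : ℕ)
  deriving DecidableEq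

/-- The cuts made so far, by name. -/
abbrev Cuts := ℕ → Option ℝ

/-- The cuts after a further cut, named `z`, at the position `c`. -/
def Cuts.add (ρ : Cuts) (z : ℕ) (c : ℝ) : Cuts := Function.update ρ z (some c)

/-- The point is `0`, `1` or a cut that has already been made. -/
def Point.Exists (ρ : Cuts) : Point → Prop
  | .left => True
  | .right => True
  | .cut z => (ρ z).isSome

/-- The position of a point (of no significance for cuts that have not been made). -/
def Point.pos (ρ : Cuts) : Point → ℝ
  | .left => 0
  | .right => 1
  | .cut z => (ρ z).getD 0

/-- `[x, y]` is an interval between two existing points, in this order. It may contain other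
cuts. -/
def IsPiece (ρ : Cuts) (x y : Point) : Prop :=
  x.Exists ρ ∧ y.Exists ρ ∧ x.pos ρ ≤ y.pos ρ

/-! ## Extended branch choice protocols -/

/-- Tree representations of extended BC protocols.
* `cut i x y z t`: agent `i` makes a cut, from then on named `z`, between the points `x` and `y`
  (there may be other cuts between them); the protocol continues with `t`.
* `choose i k t`: agent `i` chooses one of the `k + 1` children.
* `leaf A`: for every entry `(i, x, y)` of `A`, agent `i` gets the interval `[x, y]`. -/
inductive ExtBC
  | cut (agent : ℕ) (x y : Point) (z : ℕ) (next : ExtBC)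
  | choose (agent : ℕ) (k : ℕ) (next : Fin (k + 1) → ExtBC)
  | leaf (A : List (ℕ × Point × Point))

namespace ExtBC

/-- The allocation at a leaf. -/
def allocation (ρ : Cuts) (A : List (ℕ × Point × Point)) : Allocation :=
  A.map (fun p => ⟨p.1, p.2.1.pos ρ, p.2.2.pos ρ⟩)

/-- Validity of a subtree for the agents `0, …, n - 1`, when the cuts `ρ` have been made: whatever
the agents do, the end points of intervals exist and are in the correct order, and the cake is
divided at the end. -/
def ValidFrom (n : ℕ) : ExtBC → Cuts → Prop
  | cut i x y z t, ρ => i < n ∧ IsPiece ρ x y ∧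
      ∀ c ∈ Set.Icc (x.pos ρ) (y.pos ρ), ValidFrom n t (ρ.add z c)
  | choose i _ t, ρ => i < n ∧ ∀ j, ValidFrom n (t j) ρ
  | leaf A, ρ => (∀ p ∈ A, IsPiece ρ p.2.1 p.2.2) ∧ (allocation ρ A).IsDivision n

/-- `P` is an extended BC protocol for the agents `0, …, n - 1`. -/
def Valid (n : ℕ) (P : ExtBC) : Prop := P.ValidFrom n (fun _ => none)

/-- The game played in a subtree when the cuts `ρ` have been made. -/
def gameFrom : ExtBC → Cuts → Game
  | cut i x y z t, ρ =>
      .move i (Set.Icc (x.pos ρ) (y.pos ρ)) (fun c => gameFrom t (ρ.add z c.1))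
  | choose i k t, ρ => .move i (Fin (k + 1)) (fun j => gameFrom (t j) ρ)
  | leaf A, ρ => .finish (allocation ρ A)

/-- The game defined by an extended BC protocol. -/
def game (P : ExtBC) : Game := P.gameFrom (fun _ => none)

end ExtBC

/-! ## Generalised cut and choose protocols -/

/-- Conditions of if-else nodes: Boolean combinations of statements about the order of the points
and about the execution history.
* `le x y`: the point `x` is not to the right of the point `y`.
* `picked s j`: in the previous cut or choose action (`s = 0`), the one before it (`s = 1`), …,
  piece number `j` (counted from `0`) of the set offered to the agent was picked. -/
inductive Cond
  | le (x y : Point)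
  | picked (s j : ℕ)
  | not (c : Cond)
  | and (c d : Cond)

/-- Truth of a condition. The list `h` is the execution history, the most recent action first: the
number of the piece that was cut or chosen in each action. -/
def Cond.Holds (ρ : Cuts) (h : List ℕ) : Cond → Prop
  | le x y => x.pos ρ ≤ y.pos ρ
  | picked s j => h[s]? = some j
  | not c => ¬ c.Holds ρ h
  | and c d => c.Holds ρ h ∧ d.Holds ρ h

/-- The points named in the condition exist. -/
def Cond.Meaningful (ρ : Cuts) : Cond → Prop
  | le x y => x.Exists ρ ∧ y.Exists ρ
  | picked _ _ => True
  | not c => c.Meaningful ρ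
  | and c d => c.Meaningful ρ ∧ d.Meaningful ρ

/-- Tree representations of GCC protocols. A set of pieces is given as a list of pairs of points.
* `cut i S z t`: agent `i` picks a piece in `S` and makes a cut in it, from then on named `z`; the
  protocol continues with `t`.
* `choose i S t`: agent `i` picks a piece in `S`, which is allocated to `i`; the protocol continues
  with `t`.
* `ifElse k c t`: the protocol continues with the child `t j` for the first `j < k` such that the
  condition `c j` holds, and with `t k` if there is none.
* `done`: the protocol ends. -/
inductive GCC
  | cut (agent : ℕ) (S : List (Point × Point)) (z : ℕ) (next : GCC)
  | choose (agent : ℕ) (S : List (Point × Point)) (next : GCC)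
  | ifElse (k : ℕ) (c : Fin k → Cond) (next : Fin (k + 1) → GCC)
  | done

namespace GCC

/-- `S` is a nonempty set of pieces that overlap at most in end points. In the more permissive
interpretation, which is used here, the pieces may contain earlier cuts. -/
def IsPieceSet (ρ : Cuts) (S : List (Point × Point)) : Prop :=
  S ≠ [] ∧ S.Nodup ∧ (∀ p ∈ S, IsPiece ρ p.1 p.2) ∧
  S.Pairwise (fun p q =>
    Disjoint (Set.Ioo (p.1.pos ρ) (p.2.pos ρ)) (Set.Ioo (q.1.pos ρ) (q.2.pos ρ)))

open Classical in
/-- The first `j < k` such that `p j` holds, and `k` if there is none. -/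
noncomputable def branch : (k : ℕ) → (Fin k → Prop) → Fin (k + 1)
  | 0, _ => 0
  | k + 1, p => if p 0 then 0 else (branch k (fun j => p j.succ)).succ

/-- The part of the state of an execution that the nodes refer to: the cuts, the execution history
(see `Cond.Holds`), and the intervals that have been allocated. -/
structure State where
  cuts : Cuts
  history : List ℕ
  allocated : Allocation

/-- At the beginning there are no cuts, no actions and no allocated pieces. -/
def State.init : State := ⟨fun _ => none, [], []⟩

/-- The state after piece number `j` of the offered set has been cut at `c`. -/
def State.afterCut (q : State) (j : ℕ) (z : ℕ) (c : ℝ) : State :=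
  ⟨q.cuts.add z c, j :: q.history, q.allocated⟩

/-- The state after agent `i` has chosen piece number `j`, which is `[x, y]`. -/
def State.afterChoice (q : State) (j : ℕ) (i : ℕ) (x y : Point) : State :=
  ⟨q.cuts, j :: q.history, q.allocated ++ [⟨i, x.pos q.cuts, y.pos q.cuts⟩]⟩

/-- Validity of a subtree for the agents `0, …, n - 1` in a given state: in every execution, the
sets of pieces and the conditions make sense, and the cake is divided at the end. -/
def ValidFrom (n : ℕ) : GCC → State → Prop
  | cut i S z t, q => i < n ∧ IsPieceSet q.cuts S ∧
      ∀ j : Fin S.length, ∀ c ∈ Set.Icc ((S.get j).1.pos q.cuts) ((S.get j).2.pos q.cuts),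
        ValidFrom n t (q.afterCut j z c)
  | choose i S t, q => i < n ∧ IsPieceSet q.cuts S ∧
      ∀ j : Fin S.length, ValidFrom n t (q.afterChoice j i (S.get j).1 (S.get j).2)
  | ifElse k c t, q => (∀ j, (c j).Meaningful q.cuts) ∧
      ValidFrom n (t (branch k (fun j => (c j).Holds q.cuts q.history))) q
  | done, q => q.allocated.IsDivision n

/-- `Q` is a GCC protocol (in the more permissive interpretation) for the agents `0, …, n - 1`. -/
def Valid (n : ℕ) (Q : GCC) : Prop := Q.ValidFrom n State.init

/-- The game played in a subtree in a given state. -/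
noncomputable def gameFrom : GCC → State → Game
  | cut i S z t, q =>
      .move i ((j : Fin S.length) × Set.Icc ((S.get j).1.pos q.cuts) ((S.get j).2.pos q.cuts))
        (fun m => gameFrom t (q.afterCut m.1 z m.2.1))
  | choose i S t, q =>
      .move i (Fin S.length)
        (fun j => gameFrom t (q.afterChoice j i (S.get j).1 (S.get j).2))
  | ifElse k c t, q => gameFrom (t (branch k (fun j => (c j).Holds q.cuts q.history))) q
  | done, q => .finish q.allocated

/-- The game defined by a GCC protocol. -/
noncomputable def game (Q : GCC) : Game := Q.gameFrom State.init

end GCC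

/-! ## Writing protocols as strings

Trees are written in prefix notation and numbers in binary, over a finite alphabet. -/

/-- The alphabet. -/
inductive Token
  | bit (b : Bool)
  | endNum
  | left
  | right
  | name
  | piece
  | endPieces
  | cut
  | choose
  | more
  | last
  | le
  | picked
  | not
  | and
  | done
  deriving DecidableEq, Fintype

/-- The binary digits of `m`, the least significant one first, and an end mark. -/
def encodeNum (m : ℕ) : List Token := m.bits.map Token.bit ++ [.endNum]

/-- The string for a point. -/
def Point.encode : Point → List Token
  | left => [.left]
  | right => [.right]
  | cut z => .name :: encodeNum z

/-- The string for a condition. -/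
def Cond.encode : Cond → List Token
  | le x y => .le :: (x.encode ++ y.encode)
  | picked s j => .picked :: (encodeNum s ++ encodeNum j)
  | not c => .not :: c.encode
  | and c d => .and :: (c.encode ++ d.encode)

/-- The string for an extended BC protocol. -/
def ExtBC.encode : ExtBC → List Token
  | cut i x y z t =>
      .cut :: (encodeNum i ++ (x.encode ++ (y.encode ++ (encodeNum z ++ encode t))))
  | choose i k t => .choose :: (encodeNum i ++
      ((List.ofFn fun j : Fin k => .more :: encode (t j.castSucc)).flatten ++
        .last :: encode (t (Fin.last k))))
  | leaf A =>
      (A.map fun p => .piece :: (encodeNum p.1 ++ (p.2.1.encode ++ p.2.2.encode))).flatten ++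
        [.done]

/-- The string for a set of pieces. -/
def GCC.encodePieces (S : List (Point × Point)) : List Token :=
  (S.map fun p => .piece :: (p.1.encode ++ p.2.encode)).flatten ++ [.endPieces]

/-- The string for a GCC protocol. -/
def GCC.encode : GCC → List Token
  | cut i S z t => .cut :: (encodeNum i ++ (encodePieces S ++ (encodeNum z ++ encode t)))
  | choose i S t => .choose :: (encodeNum i ++ (encodePieces S ++ encode t))
  | ifElse k c t =>
      (List.ofFn fun j : Fin k => .more :: ((c j).encode ++ encode (t j.castSucc))).flatten ++
        .last :: encode (t (Fin.last k))
  | done => [.done]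

/-! ### The encodings are injective, no string being a proper prefix of another -/

theorem encodeNum_prefix {m m' : ℕ} {r r' : List Token}
    (h : encodeNum m ++ r = encodeNum m' ++ r') : m = m' ∧ r = r' := by
  have key : ∀ l l' : List Bool, l.map Token.bit ++ ([.endNum] ++ r) =
      l'.map Token.bit ++ ([.endNum] ++ r') → l = l' ∧ r = r' := by
    intro l
    induction l with
    | nil => intro l' h; cases l' <;> simp_all
    | cons a l ih =>
      intro l' h
      cases l' with
      | nil => simp at h
      | cons a' l' =>
        simp only [List.map_cons, List.cons_append, List.cons.injEq, Token.bit.injEq] at h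
        obtain ⟨h1, h2⟩ := ih l' h.2
        exact ⟨by rw [h.1, h1], h2⟩
  simp only [encodeNum, List.append_assoc] at h
  obtain ⟨h1, h2⟩ := key _ _ h
  refine ⟨?_, h2⟩
  have : Function.Injective Nat.bits := by
    intro a
    induction a using Nat.binaryRec' with
    | zero =>
      intro b hb
      induction b using Nat.binaryRec' with
      | zero => rfl
      | bit c b hc _ => simp [Nat.bits_append_bit b c hc] at hb
    | bit c a hc ih =>
      intro b hb
      induction b using Nat.binaryRec' with
      | zero => simp [Nat.bits_append_bit a c hc] at hb
      | bit d b hd _ =>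
        rw [Nat.bits_append_bit a c hc, Nat.bits_append_bit b d hd] at hb
        simp only [List.cons.injEq] at hb
        rw [hb.1, ih hb.2]
  exact this h1

theorem Point.encode_prefix {x x' : Point} {r r' : List Token}
    (h : x.encode ++ r = x'.encode ++ r') : x = x' ∧ r = r' := by
  cases x <;> cases x' <;> simp [Point.encode] at h <;> try simp [h]
  obtain ⟨h1, h2⟩ := encodeNum_prefix h
  exact ⟨h1, h2⟩

theorem Cond.encode_prefix {c c' : Cond} {r r' : List Token}
    (h : c.encode ++ r = c'.encode ++ r') : c = c' ∧ r = r' := by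
  induction c generalizing c' r r' with
  | le x y =>
    cases c' <;> simp [Cond.encode] at h
    replace h := Point.encode_prefix h
    obtain ⟨rfl, h⟩ := h
    replace h := Point.encode_prefix h
    obtain ⟨rfl, h⟩ := h
    exact ⟨rfl, h⟩
  | picked s j =>
    cases c' <;> simp [Cond.encode] at h
    replace h := encodeNum_prefix h
    obtain ⟨rfl, h⟩ := h
    replace h := encodeNum_prefix h
    obtain ⟨rfl, h⟩ := h
    exact ⟨rfl, h⟩
  | not c ih =>
    cases c' <;> simp [Cond.encode] at h
    replace h := ih h
    obtain ⟨rfl, h⟩ := h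
    exact ⟨rfl, h⟩
  | and c d ih1 ih2 =>
    cases c' <;> simp [Cond.encode] at h
    replace h := ih1 h
    obtain ⟨rfl, h⟩ := h
    replace h := ih2 h
    obtain ⟨rfl, h⟩ := h
    exact ⟨rfl, h⟩

theorem ExtBC.encode_prefix {P P' : ExtBC} {r r' : List Token}
    (h : P.encode ++ r = P'.encode ++ r') : P = P' ∧ r = r' := by
  induction P generalizing P' r r' with
  | cut i x y z t ih =>
    cases P' with
    | cut i' x' y' z' t' =>
      simp only [ExtBC.encode, List.cons_append, List.append_assoc, List.cons.injEq,
        true_and] at h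
      replace h := encodeNum_prefix h
      obtain ⟨rfl, h⟩ := h
      replace h := Point.encode_prefix h
      obtain ⟨rfl, h⟩ := h
      replace h := Point.encode_prefix h
      obtain ⟨rfl, h⟩ := h
      replace h := encodeNum_prefix h
      obtain ⟨rfl, h⟩ := h
      replace h := ih h
      obtain ⟨rfl, h⟩ := h
      exact ⟨rfl, h⟩
    | choose => simp [ExtBC.encode] at h
    | leaf A => cases A <;> simp [ExtBC.encode] at h
  | choose i k t ih =>
    cases P' with
    | cut => simp [ExtBC.encode] at h
    | choose i' k' t' =>
      simp only [ExtBC.encode, List.cons_append, List.append_assoc, List.cons.injEq,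
        true_and] at h
      replace h := encodeNum_prefix h
      obtain ⟨rfl, h⟩ := h
      have key : ∃ e : k = k', (∀ j, t j = t' (Fin.cast (by rw [e]) j)) ∧ r = r' := by
        induction k generalizing k' with
        | zero =>
          cases k' with
          | zero =>
            simp at h
            obtain ⟨h1, h2⟩ := ih 0 h
            refine ⟨rfl, fun j => ?_, h2⟩
            rw [Fin.fin_one_eq_zero j]; exact h1
          | succ k' => simp [List.ofFn_succ] at h
        | succ k IH =>
          cases k' with
          | zero => simp [List.ofFn_succ] at h
          | succ k' =>
            simp only [List.ofFn_succ, List.flatten_cons, List.cons_append, List.append_assoc,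
              List.cons.injEq, true_and] at h
            replace h := ih _ h
            obtain ⟨h1, h⟩ := h
            obtain ⟨e, h2, h3⟩ := IH (fun j => t j.succ) (fun j => ih j.succ) k'
              (fun j => t' j.succ) (by simpa using h)
            subst e
            refine ⟨rfl, fun j => ?_, h3⟩
            refine Fin.cases ?_ (fun j => ?_) j
            · exact h1
            · exact h2 j
      obtain ⟨rfl, h1, h2⟩ := key
      exact ⟨by rw [show t = t' from funext h1], h2⟩
    | leaf A => cases A <;> simp [ExtBC.encode] at h
  | leaf A =>
    cases P' with
    | cut => cases A <;> simp [ExtBC.encode] at h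
    | choose => cases A <;> simp [ExtBC.encode] at h
    | leaf A' =>
      simp only [ExtBC.encode, List.append_assoc] at h
      induction A generalizing A' with
      | nil => cases A' <;> simp at h; simp [h]
      | cons p A IH =>
        cases A' with
        | nil => simp at h
        | cons p' A' =>
          obtain ⟨i, x, y⟩ := p
          obtain ⟨i', x', y'⟩ := p'
          simp only [List.map_cons, List.flatten_cons, List.cons_append, List.append_assoc,
            List.cons.injEq, true_and] at h
          replace h := encodeNum_prefix h
          obtain ⟨rfl, h⟩ := h
          replace h := Point.encode_prefix h
          obtain ⟨rfl, h⟩ := h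
          replace h := Point.encode_prefix h
          obtain ⟨rfl, h⟩ := h
          replace h := IH A' h
          obtain ⟨h1, h⟩ := h
          simp only [ExtBC.leaf.injEq] at h1
          exact ⟨by rw [h1], h⟩

theorem GCC.encodePieces_prefix {S S' : List (Point × Point)} {r r' : List Token}
    (h : GCC.encodePieces S ++ r = GCC.encodePieces S' ++ r') : S = S' ∧ r = r' := by
  simp only [GCC.encodePieces, List.append_assoc] at h
  induction S generalizing S' with
  | nil => cases S' <;> simp at h; simp [h]
  | cons p S IH =>
    cases S' with
    | nil => simp at h
    | cons p' S' =>
      obtain ⟨x, y⟩ := p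
      obtain ⟨x', y'⟩ := p'
      simp only [List.map_cons, List.flatten_cons, List.cons_append, List.append_assoc,
        List.cons.injEq, true_and] at h
      replace h := Point.encode_prefix h
      obtain ⟨rfl, h⟩ := h
      replace h := Point.encode_prefix h
      obtain ⟨rfl, h⟩ := h
      replace h := IH h
      obtain ⟨rfl, h⟩ := h
      exact ⟨rfl, h⟩

theorem GCC.encode_prefix {Q Q' : GCC} {r r' : List Token}
    (h : Q.encode ++ r = Q'.encode ++ r') : Q = Q' ∧ r = r' := by
  induction Q generalizing Q' r r' with
  | cut i S z t ih =>
    cases Q' with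
    | cut i' S' z' t' =>
      simp only [GCC.encode, List.cons_append, List.append_assoc, List.cons.injEq, true_and] at h
      replace h := encodeNum_prefix h
      obtain ⟨rfl, h⟩ := h
      replace h := GCC.encodePieces_prefix h
      obtain ⟨rfl, h⟩ := h
      replace h := encodeNum_prefix h
      obtain ⟨rfl, h⟩ := h
      replace h := ih h
      obtain ⟨rfl, h⟩ := h
      exact ⟨rfl, h⟩
    | ifElse k => cases k <;> simp [GCC.encode, List.ofFn_succ] at h
    | _ => simp [GCC.encode] at h
  | choose i S t ih =>
    cases Q' with
    | choose i' S' t' =>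
      simp only [GCC.encode, List.cons_append, List.append_assoc, List.cons.injEq, true_and] at h
      replace h := encodeNum_prefix h
      obtain ⟨rfl, h⟩ := h
      replace h := GCC.encodePieces_prefix h
      obtain ⟨rfl, h⟩ := h
      replace h := ih h
      obtain ⟨rfl, h⟩ := h
      exact ⟨rfl, h⟩
    | ifElse k => cases k <;> simp [GCC.encode, List.ofFn_succ] at h
    | _ => simp [GCC.encode] at h
  | ifElse k c t ih =>
    cases Q' with
    | ifElse k' c' t' =>
      simp only [GCC.encode, List.append_assoc] at h
      have key : ∃ e : k = k', (∀ j, c j = c' (Fin.cast e j)) ∧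
          (∀ j, t j = t' (Fin.cast (by rw [e]) j)) ∧ r = r' := by
        induction k generalizing k' with
        | zero =>
          cases k' with
          | zero =>
            simp at h
            obtain ⟨h1, h2⟩ := ih 0 h
            refine ⟨rfl, fun j => j.elim0, fun j => ?_, h2⟩
            rw [Fin.fin_one_eq_zero j]; exact h1
          | succ k' => simp [List.ofFn_succ] at h
        | succ k IH =>
          cases k' with
          | zero => simp [List.ofFn_succ] at h
          | succ k' =>
            simp only [List.ofFn_succ, List.flatten_cons, List.cons_append, List.append_assoc,
              List.cons.injEq, true_and] at h
            replace h := Cond.encode_prefix h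
            obtain ⟨h0, h⟩ := h
            replace h := ih _ h
            obtain ⟨h1, h⟩ := h
            obtain ⟨e, h2, h3, h4⟩ := IH (fun j => c j.succ) (fun j => t j.succ)
              (fun j => ih j.succ) k' (fun j => c' j.succ) (fun j => t' j.succ) (by simpa using h)
            subst e
            refine ⟨rfl, fun j => ?_, fun j => ?_, h4⟩
            · refine Fin.cases ?_ (fun j => ?_) j
              · exact h0
              · exact h2 j
            · refine Fin.cases ?_ (fun j => ?_) j
              · exact h1
              · exact h3 j
      obtain ⟨rfl, h0, h1, h2⟩ := key
      exact ⟨by rw [show c = c' from funext h0, show t = t' from funext h1], h2⟩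
    | _ => cases k <;> simp [GCC.encode, List.ofFn_succ] at h
  | done =>
    cases Q' with
    | done => simpa [GCC.encode] using h
    | ifElse k => cases k <;> simp [GCC.encode, List.ofFn_succ] at h
    | _ => simp [GCC.encode] at h

/-- The encoding of extended BC protocols. -/
noncomputable def ExtBC.encoding : Computability.Encoding ExtBC Token where
  encode := ExtBC.encode
  decode := Function.partialInv ExtBC.encode
  decode_encode := Function.partialInv_left
    (fun _ _ h => (ExtBC.encode_prefix (r := []) (r' := []) (congrArg (· ++ []) h)).1)

/-- The encoding of GCC protocols. -/
noncomputable def GCC.encoding : Computability.Encoding GCC Token where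
  encode := GCC.encode
  decode := Function.partialInv GCC.encode
  decode_encode := Function.partialInv_left
    (fun _ _ h => (GCC.encode_prefix (r := []) (r' := []) (congrArg (· ++ []) h)).1)

end CakeCutting

/-!
The difficulty is that in a GCC protocol an agent has no choice but between pieces, and choosing a
piece allocates it. The way out is to let agents choose by *cutting*. At the beginning somebody
makes an auxiliary cut, which is never used as an end point in the division. When agent `i` has to
decide between two ways to continue, `i` is asked to make the auxiliary cut anew, either in the part
of the cake on the left of it or in the part on the right of it; which of the two was picked is in
the execution history, so that an if-else node can branch on it. Since pieces may contain earlier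
cuts, this has no effect on the rest of the protocol. A choose node with `k + 1` children becomes
`k` such binary decisions (`menu`), a cut node becomes a cut node with one piece, and a leaf becomes
a chain of choose nodes with one piece each (`allot`). At corresponding positions every agent can
force the same properties of the allocation (`translate_correct`); that this determines what can be
guaranteed is the equivalence of strategies with backward induction
(`Game.exists_strategy_iff_wins`).

On strings, the translation is a replacement of tokens, except that a token `more` is to be replaced
by a string that contains the agent of the choose node to which it belongs. A machine with a stack
for the agents of the choose nodes that are still open does this in one pass (`processes_encode`).
On average, a token of the input costs at most a linear number of steps, for reading an agent from
this stack and storing it again, so that the time is quadratic.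
-/

namespace CakeCutting

/-! ### Guarantees as winning positions -/

/-- Agent `i` can force an allocation satisfying `F`, in the backward-induction sense: at the
positions of `i` some move has to work, at all others every move. -/
def Game.Wins (F : Allocation → Prop) (i : ℕ) : Game → Prop
  | .finish A => F A
  | .move agent M next =>
      if agent = i then ∃ m : M, (next m).Wins F i else ∀ m : M, (next m).Wins F i

/-- No position of the game leaves an agent without a move. Without this, an agent might have no
strategy at all. -/
def Game.Live : Game → Prop
  | .finish _ => True
  | .move _ M next => Nonempty M ∧ ∀ m : M, (next m).Live

theorem Game.Live.nonempty_strategy (j : ℕ) : ∀ {g : Game}, g.Live → Nonempty (g.Strategy j)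
  | .finish _, _ => ⟨()⟩
  | .move _ _ _, ⟨⟨m₀⟩, h⟩ =>
      ⟨(fun _ => m₀, fun m => Classical.choice ((h m).nonempty_strategy j))⟩

/-- Strategies for all positions, seen from the root, amount to backward induction. -/
theorem Game.exists_strategy_iff_wins (F : Allocation → Prop) (i : ℕ) : ∀ {g : Game}, g.Live →
    ((∃ σ : g.Strategy i, ∀ s : (j : ℕ) → g.Strategy j, s i = σ → F (g.outcome s)) ↔ g.Wins F i)
  | .finish A, _ => by
      refine ⟨fun ⟨σ, h⟩ => ?_, fun h => ⟨(), fun _ _ => h⟩⟩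
      exact h (fun _ => ()) rfl
  | .move agent M next, ⟨⟨m₀⟩, hl⟩ => by
      have ih := fun m => exists_strategy_iff_wins F i (hl m)
      have inh : ∀ (j : ℕ) (m : M), Nonempty ((next m).Strategy j) :=
        fun j m => (hl m).nonempty_strategy j
      -- A profile for the subgame at `m` extends to one in which `m` is played and `i` uses `σ`.
      have ext : ∀ (σ : Game.Strategy i (.move agent M next)) (m : M),
          (∀ h : agent = i, σ.1 h = m) →
          (∀ s : (j : ℕ) → Game.Strategy j (.move agent M next), s i = σ →
            F (Game.outcome (.move agent M next) s)) →
          ∀ s : (j : ℕ) → (next m).Strategy j, s i = σ.2 m → F ((next m).outcome s) := by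
        intro σ m hm H s hs
        classical
        let s' : (j : ℕ) → Game.Strategy j (.move agent M next) := fun j =>
          if h : j = i then cast (by rw [h]) σ
          else (fun _ => m, fun m' => if e : m' = m then cast (by rw [e]) (s j)
            else Classical.choice (inh j m'))
        have h1 : (s' agent).1 rfl = m := by
          by_cases h : agent = i
          · subst h
            simpa [s'] using hm rfl
          · simp [s', h]
        have h2 : ∀ j, (s' j).2 m = s j := by
          intro j
          by_cases h : j = i
          · subst h
            simpa [s'] using hs.symm
          · simp [s', h]
        have h3 := H s' (by simp [s'])
        simp only [Game.outcome] at h3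
        rw [h1] at h3
        simpa only [h2] using h3
      by_cases ha : agent = i
      · simp only [Game.Wins, if_pos ha, ← ih]
        constructor
        · rintro ⟨σ, H⟩
          exact ⟨σ.1 ha, σ.2 _, ext σ _ (fun _ => rfl) H⟩
        · rintro ⟨m, σ, H⟩
          classical
          refine ⟨(fun _ => m, fun m' => if e : m' = m then cast (by rw [e]) σ
            else Classical.choice (inh i m')), fun s hs => ?_⟩
          subst ha
          simp only [Game.outcome]
          have h1 : (s agent).1 rfl = m := by rw [hs]
          rw [h1]
          refine H _ ?_
          simp [hs]
      · simp only [Game.Wins, if_neg ha, ← ih]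
        constructor
        · rintro ⟨σ, H⟩ m
          exact ⟨σ.2 m, ext σ m (fun h => absurd h ha) H⟩
        · intro H
          choose σ hσ using H
          refine ⟨(fun h => absurd h ha, σ), fun s hs => ?_⟩
          exact hσ _ _ (by simp [hs])

/-- Games in which every agent can force the same properties of the allocation do not differ in the
bounds on envy that can be guaranteed. -/
theorem stronglyEnvyEquivalent_of_wins_iff {n : ℕ} {g g' : Game} (hg : g.Live) (hg' : g'.Live)
    (h : ∀ F i, g.Wins F i ↔ g'.Wins F i) : StronglyEnvyEquivalent n g g' := by
  intro V i _ S _ _ b _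
  have key : ∀ {g : Game}, g.Live →
      (g.CanGuarantee V i S b ↔ g.Wins (fun A => ∀ j ∈ S, A.envy V i j ≤ b j) i) :=
    fun hg => Game.exists_strategy_iff_wins (fun A => ∀ j ∈ S, A.envy V i j ≤ b j) i hg
  rw [key hg, key hg', h]

theorem ExtBC.ValidFrom.live {n : ℕ} {P : ExtBC} : ∀ {ρ : Cuts}, P.ValidFrom n ρ →
    (P.gameFrom ρ).Live := by
  induction P with
  | cut i x y z t ih =>
    rintro ρ ⟨-, ⟨-, -, h⟩, ht⟩
    exact ⟨⟨⟨_, le_rfl, h⟩⟩, fun c => ih (ht c c.2)⟩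
  | choose i k t ih => exact fun ⟨_, ht⟩ => ⟨⟨0⟩, fun j => ih j (ht j)⟩
  | leaf A => exact fun _ => trivial

theorem GCC.ValidFrom.live {n : ℕ} {Q : GCC} : ∀ {q : GCC.State}, Q.ValidFrom n q →
    (Q.gameFrom q).Live := by
  induction Q with
  | cut i S z t ih =>
    rintro q ⟨-, ⟨h0, -, hS, -⟩, ht⟩
    have j : Fin S.length := ⟨0, List.length_pos_iff.2 h0⟩
    exact ⟨⟨⟨j, _, le_rfl, (hS _ (List.get_mem S j)).2.2⟩⟩, fun m => ih (ht _ _ m.2.2)⟩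
  | choose i S t ih =>
    rintro q ⟨-, ⟨h0, -, hS, -⟩, ht⟩
    exact ⟨⟨⟨0, List.length_pos_iff.2 h0⟩⟩, fun m => ih (ht _)⟩
  | ifElse k c t ih => exact fun ⟨_, ht⟩ => ih _ ht
  | done => exact fun _ => trivial

/-! ### The translation -/

/-- Cuts are renamed so that the name `0` becomes free; in binary this puts a digit `1` in front. -/
def Point.rename : Point → Point
  | .left => .left
  | .right => .right
  | .cut z => .cut (2 * z + 1)

/-- The two pieces into which the auxiliary cut, named `0`, divides the cake. -/
def halves : List (Point × Point) := [(.left, .cut 0), (.cut 0, .right)]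

/-- Agent `i` decides between `t 0, …, t k`: by making the auxiliary cut anew in the left half, `i`
opts for `t 0`, and by making it in the right half, for a decision between the others. -/
def menu (i : ℕ) : (k : ℕ) → (Fin (k + 1) → GCC) → GCC
  | 0, t => t 0
  | k + 1, t => .cut i halves 0
      (.ifElse 1 (fun _ => .picked 0 0) ![t 0, menu i k fun j => t j.succ])

/-- The intervals of `A` are allocated one by one. -/
def allot : List (ℕ × Point × Point) → GCC
  | [] => .done
  | p :: A => .choose p.1 [(p.2.1.rename, p.2.2.rename)] (allot A)

/-- The translation of a subtree, for use after the auxiliary cut has been made. The trivial if-else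
node around a menu makes the string of the translation easier to produce: its `last` is what the
first token `more` or `last` of the choose node contributes. -/
def translate : ExtBC → GCC
  | .cut i x y z t => .cut i [(x.rename, y.rename)] (2 * z + 1) (translate t)
  | .choose i k t => .ifElse 0 Fin.elim0 fun _ => menu i k fun j => translate (t j)
  | .leaf A => allot A

/-- Agent `0` makes the auxiliary cut anywhere, then the translation of the protocol is executed. -/
def convert (P : ExtBC) : GCC := .cut 0 [(.left, .right)] 0 (translate P)

/-! ### Correctness of the translation -/

/-- The state `q` of the translation corresponds to the cuts `ρ` of the original protocol. -/
structure Matches (ρ : Cuts) (q : GCC.State) : Prop where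
  cuts : ∀ z, q.cuts (2 * z + 1) = ρ z
  aux : ∃ c ∈ Set.Icc (0 : ℝ) 1, q.cuts 0 = some c
  allocated : q.allocated = []

namespace Matches

variable {ρ : Cuts} {q : GCC.State}

theorem pos_rename (h : ∀ z, q.cuts (2 * z + 1) = ρ z) (x : Point) :
    x.rename.pos q.cuts = x.pos ρ := by
  cases x <;> simp [Point.rename, Point.pos, h]

theorem isPiece_rename (h : ∀ z, q.cuts (2 * z + 1) = ρ z) {x y : Point} (hp : IsPiece ρ x y) :
    IsPiece q.cuts x.rename y.rename := by
  have hex : ∀ x : Point, x.Exists ρ → x.rename.Exists q.cuts := by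
    intro x; cases x <;> simp [Point.rename, Point.Exists, h]
  exact ⟨hex x hp.1, hex y hp.2.1, by simpa only [pos_rename h] using hp.2.2⟩

theorem afterCut (h : Matches ρ q) (j z : ℕ) (c : ℝ) :
    Matches (ρ.add z c) (q.afterCut j (2 * z + 1) c) where
  cuts w := by
    by_cases hw : w = z
    · simp [GCC.State.afterCut, Cuts.add, hw]
    · have : 2 * w + 1 ≠ 2 * z + 1 := by omega
      simp [GCC.State.afterCut, Cuts.add, hw, h.cuts]
  aux := by
    obtain ⟨d, hd, e⟩ := h.aux
    exact ⟨d, hd, by simpa [GCC.State.afterCut, Cuts.add, Function.update] using e⟩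
  allocated := h.allocated

theorem afterAuxCut (h : ∀ z, q.cuts (2 * z + 1) = ρ z) (ha : q.allocated = []) (j : ℕ) {c : ℝ}
    (hc : c ∈ Set.Icc (0 : ℝ) 1) : Matches ρ (q.afterCut j 0 c) where
  cuts w := by simp [GCC.State.afterCut, Cuts.add, h]
  aux := ⟨c, hc, by simp [GCC.State.afterCut, Cuts.add]⟩
  allocated := ha

end Matches

theorem isPieceSet_singleton {ρ : Cuts} {x y : Point} (h : IsPiece ρ x y) :
    GCC.IsPieceSet ρ [(x, y)] := by
  simpa [GCC.IsPieceSet] using h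

theorem Matches.isPieceSet_halves {ρ : Cuts} {q : GCC.State} (h : Matches ρ q) :
    GCC.IsPieceSet q.cuts halves := by
  obtain ⟨c, ⟨h0, h1⟩, e⟩ := h.aux
  simp [GCC.IsPieceSet, halves, IsPiece, Point.Exists, Point.pos, e, h0, h1,
    Set.disjoint_left]
  intro a _ h2 h3
  linarith

/-- A menu of correct subtrees is correct: the agent has the same `k + 1` options as at a choose
node. -/
theorem menu_correct {n i a : ℕ} {F : Allocation → Prop} {ρ : Cuts} (ha : a < n) (k : ℕ) :
    ∀ {t : Fin (k + 1) → GCC} {W : Fin (k + 1) → Prop},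
      (∀ j q, Matches ρ q → (t j).ValidFrom n q ∧ (((t j).gameFrom q).Wins F i ↔ W j)) →
      ∀ q, Matches ρ q → (menu a k t).ValidFrom n q ∧
        (((menu a k t).gameFrom q).Wins F i ↔ if a = i then ∃ j, W j else ∀ j, W j) := by
  induction k with
  | zero =>
    intro t W ht q hq
    refine ⟨(ht 0 q hq).1, ?_⟩
    simpa [menu, Fin.exists_fin_one] using (ht 0 q hq).2
  | succ k ih =>
    intro t W ht q hq
    have ih' := ih (t := fun j => t j.succ) (W := fun j => W j.succ) (fun j => ht j.succ)
    obtain ⟨c, ⟨h0, h1⟩, e⟩ := hq.aux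
    have hc : (Point.cut 0).pos q.cuts = c := by simp [Point.pos, e]
    have hm : ∀ (j : ℕ) {d : ℝ}, d ∈ Set.Icc (0 : ℝ) 1 → Matches ρ (q.afterCut j 0 d) :=
      fun j d hd => Matches.afterAuxCut hq.cuts hq.allocated j hd
    have sub : ∀ (j : Fin halves.length) {d : ℝ},
        d ∈ Set.Icc ((halves.get j).1.pos q.cuts) ((halves.get j).2.pos q.cuts) →
        d ∈ Set.Icc (0 : ℝ) 1 := by
      intro j d hd
      fin_cases j
      · exact ⟨hd.1, (hd.2.trans hc.le).trans h1⟩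
      · exact ⟨h0.trans (hc.ge.trans hd.1), hd.2⟩
    -- The two ways to continue, depending on the half in which the auxiliary cut is made.
    have key₀ : ∀ {d : ℝ}, d ∈ Set.Icc (0 : ℝ) 1 → _ := fun hd => ht 0 _ (hm 0 hd)
    have key₁ : ∀ {d : ℝ}, d ∈ Set.Icc (0 : ℝ) 1 → _ := fun hd => ih' _ (hm 1 hd)
    have b₀ : ∀ d, GCC.branch 1 (fun _ => (Cond.picked 0 0).Holds (q.afterCut 0 0 d).cuts
        (q.afterCut 0 0 d).history) = 0 := by
      intro d; simp [GCC.branch, Cond.Holds, GCC.State.afterCut]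
    have b₁ : ∀ d, GCC.branch 1 (fun _ => (Cond.picked 0 0).Holds (q.afterCut 1 0 d).cuts
        (q.afterCut 1 0 d).history) = 1 := by
      intro d; simp [GCC.branch, Cond.Holds, GCC.State.afterCut]
    constructor
    · refine ⟨ha, hq.isPieceSet_halves, fun j d hd => ⟨fun _ => trivial, ?_⟩⟩
      have hd' := sub j hd
      fin_cases j
      · simp only [b₀]
        exact (key₀ hd').1
      · simp only [b₁]
        exact (key₁ hd').1
    · have w₀ : ∀ {d : ℝ}, d ∈ Set.Icc (0 : ℝ) 1 → ((((GCC.ifElse 1 (fun _ => .picked 0 0)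
          ![t 0, menu a k fun j => t j.succ]).gameFrom (q.afterCut 0 0 d)).Wins F i) ↔ W 0) := by
        intro d hd
        simp only [GCC.gameFrom, b₀]
        exact (key₀ hd).2
      have w₁ : ∀ {d : ℝ}, d ∈ Set.Icc (0 : ℝ) 1 → ((((GCC.ifElse 1 (fun _ => .picked 0 0)
          ![t 0, menu a k fun j => t j.succ]).gameFrom (q.afterCut 1 0 d)).Wins F i) ↔
          if a = i then ∃ j : Fin (k + 1), W j.succ else ∀ j : Fin (k + 1), W j.succ) := by
        intro d hd
        simp only [GCC.gameFrom, b₁]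
        exact (key₁ hd).2
      have c₀ : c ∈ Set.Icc ((halves.get (0 : Fin 2)).1.pos q.cuts)
          ((halves.get (0 : Fin 2)).2.pos q.cuts) :=
        ⟨h0, hc.ge⟩
      have c₁ : c ∈ Set.Icc ((halves.get (1 : Fin 2)).1.pos q.cuts)
          ((halves.get (1 : Fin 2)).2.pos q.cuts) :=
        ⟨hc.le, h1⟩
      by_cases hai : a = i
      · simp only [if_pos hai] at w₁
        simp only [menu, GCC.gameFrom, Game.Wins, if_pos hai, Fin.exists_fin_succ (P := W)]
        constructor
        · rintro ⟨⟨j, d, hd⟩, hw⟩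
          have hd' := sub j hd
          fin_cases j
          · exact Or.inl ((w₀ hd').1 hw)
          · exact Or.inr ((w₁ hd').1 hw)
        · rintro (hw | hw)
          · exact ⟨⟨(0 : Fin 2), c, c₀⟩, (w₀ ⟨h0, h1⟩).2 hw⟩
          · exact ⟨⟨(1 : Fin 2), c, c₁⟩, (w₁ ⟨h0, h1⟩).2 hw⟩
      · simp only [if_neg hai] at w₁
        simp only [menu, GCC.gameFrom, Game.Wins, if_neg hai, Fin.forall_fin_succ (P := W)]
        constructor
        · intro hw
          exact ⟨(w₀ ⟨h0, h1⟩).1 (hw ⟨(0 : Fin 2), c, c₀⟩),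
            (w₁ ⟨h0, h1⟩).1 (hw ⟨(1 : Fin 2), c, c₁⟩)⟩
        · rintro ⟨hw₀, hw₁⟩ ⟨j, d, hd⟩
          have hd' := sub j hd
          fin_cases j
          · exact (w₀ hd').2 hw₀
          · exact (w₁ hd').2 hw₁

theorem allot_correct {n i : ℕ} {F : Allocation → Prop} {ρ : Cuts}
    (A : List (ℕ × Point × Point)) :
    ∀ q : GCC.State, (∀ z, q.cuts (2 * z + 1) = ρ z) → (∀ p ∈ A, p.1 < n) →
      (∀ p ∈ A, IsPiece ρ p.2.1 p.2.2) →
      (q.allocated ++ ExtBC.allocation ρ A).IsDivision n →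
      (allot A).ValidFrom n q ∧
        (((allot A).gameFrom q).Wins F i ↔ F (q.allocated ++ ExtBC.allocation ρ A)) := by
  induction A with
  | nil =>
    intro q _ _ _ hd
    simp only [ExtBC.allocation, List.map_nil, List.append_nil] at hd ⊢
    exact ⟨hd, Iff.rfl⟩
  | cons p A ih =>
    intro q hq hn hp hd
    have e : q.allocated ++ ExtBC.allocation ρ (p :: A) =
        (q.afterChoice 0 p.1 p.2.1.rename p.2.2.rename).allocated ++ ExtBC.allocation ρ A := by
      simp [GCC.State.afterChoice, ExtBC.allocation, Matches.pos_rename hq]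
    rw [e] at hd ⊢
    have := ih (q.afterChoice 0 p.1 p.2.1.rename p.2.2.rename) hq
      (fun r hr => hn r (List.mem_cons_of_mem _ hr))
      (fun r hr => hp r (List.mem_cons_of_mem _ hr)) hd
    constructor
    · refine ⟨hn p List.mem_cons_self, isPieceSet_singleton
        (Matches.isPiece_rename hq (hp p List.mem_cons_self)), fun j => ?_⟩
      have hj : j = 0 := Fin.fin_one_eq_zero j
      subst hj
      exact this.1
    · rw [← this.2]
      change (if p.1 = i then ∃ m : Fin 1, _ else ∀ m : Fin 1, _) ↔ _
      rw [Fin.exists_fin_one, Fin.forall_fin_one, ite_self]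
      rfl

/-- From corresponding states, the translation of a valid subtree is valid, and every agent can
force exactly the same properties of the allocation as in the original. -/
theorem translate_correct {n i : ℕ} {F : Allocation → Prop} {P : ExtBC} :
    ∀ {ρ : Cuts}, P.ValidFrom n ρ → ∀ q, Matches ρ q →
      (translate P).ValidFrom n q ∧
        (((translate P).gameFrom q).Wins F i ↔ (P.gameFrom ρ).Wins F i) := by
  induction P with
  | cut a x y z t ih =>
    rintro ρ ⟨ha, hp, ht⟩ q hq
    have ex := Matches.pos_rename hq.cuts x
    have ey := Matches.pos_rename hq.cuts y
    have key : ∀ c ∈ Set.Icc (x.pos ρ) (y.pos ρ), _ :=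
      fun c hc => ih (ht c hc) _ (hq.afterCut 0 z c)
    constructor
    · refine ⟨ha, isPieceSet_singleton (Matches.isPiece_rename hq.cuts hp), fun j c hc => ?_⟩
      have hj : j = 0 := Fin.fin_one_eq_zero j
      subst hj
      exact (key c ⟨ex.ge.trans hc.1, hc.2.trans ey.le⟩).1
    · by_cases hai : a = i
      · simp only [translate, GCC.gameFrom, ExtBC.gameFrom, Game.Wins, if_pos hai]
        constructor
        · rintro ⟨⟨j, c, hc⟩, hw⟩
          have hj : j = 0 := Fin.fin_one_eq_zero j
          subst hj
          have hc' : c ∈ Set.Icc (x.pos ρ) (y.pos ρ) :=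
            ⟨ex.ge.trans hc.1, hc.2.trans ey.le⟩
          exact ⟨⟨c, hc'⟩, (key c hc').2.1 hw⟩
        · rintro ⟨⟨c, hc⟩, hw⟩
          exact ⟨⟨0, c, ex.le.trans hc.1, hc.2.trans ey.ge⟩, (key c hc).2.2 hw⟩
      · simp only [translate, GCC.gameFrom, ExtBC.gameFrom, Game.Wins, if_neg hai]
        constructor
        · rintro hw ⟨c, hc⟩
          exact (key c hc).2.1 (hw ⟨0, c, ex.le.trans hc.1, hc.2.trans ey.ge⟩)
        · rintro hw ⟨j, c, hc⟩
          have hj : j = 0 := Fin.fin_one_eq_zero j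
          subst hj
          have hc' : c ∈ Set.Icc (x.pos ρ) (y.pos ρ) :=
            ⟨ex.ge.trans hc.1, hc.2.trans ey.le⟩
          exact (key c hc').2.2 (hw ⟨c, hc'⟩)
  | choose a k t ih =>
    rintro ρ ⟨ha, ht⟩ q hq
    have := menu_correct ha k (fun j q' hq' => ih j (ht j) q' hq') q hq
    exact ⟨⟨fun j => j.elim0, this.1⟩, this.2⟩
  | leaf A =>
    rintro ρ ⟨hp, hd⟩ q hq
    have hn : ∀ p ∈ A, p.1 < n := fun p hpA => (hd.1 _ (List.mem_map_of_mem hpA)).1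
    have := allot_correct (F := F) (i := i) A q hq.cuts hn hp (by simpa [hq.allocated] using hd)
    rw [hq.allocated] at this
    exact this

theorem ExtBC.ValidFrom.pos {n : ℕ} {P : ExtBC} : ∀ {ρ : Cuts}, P.ValidFrom n ρ → 0 < n := by
  cases P with
  | cut => exact fun h => h.1.pos
  | choose => exact fun h => h.1.pos
  | leaf A =>
    rintro ρ ⟨-, h, -, hc⟩
    have h0 : (0 : ℝ) ∈ Set.Icc (0 : ℝ) 1 := by simp
    rw [← hc] at h0
    simp only [Set.mem_iUnion] at h0
    obtain ⟨s, hs, -⟩ := h0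
    exact (h s hs).1.pos

theorem convert_correct {n : ℕ} {P : ExtBC} (h : P.Valid n) :
    (convert P).Valid n ∧ StronglyEnvyEquivalent n P.game (convert P).game := by
  have hm : ∀ {c : ℝ}, c ∈ Set.Icc (0 : ℝ) 1 →
      Matches (fun _ => none) (GCC.State.init.afterCut 0 0 c) :=
    fun hc => Matches.afterAuxCut (q := GCC.State.init) (fun _ => rfl) rfl 0 hc
  have hv : (convert P).Valid n := by
    refine ⟨h.pos, isPieceSet_singleton ⟨trivial, trivial, zero_le_one⟩, fun j c hc => ?_⟩
    have hj : j = 0 := Fin.fin_one_eq_zero j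
    subst hj
    exact (translate_correct (F := fun _ => True) (i := 0) h _ (hm hc)).1
  refine ⟨hv, stronglyEnvyEquivalent_of_wins_iff h.live hv.live fun F i => ?_⟩
  have key : ∀ {c : ℝ}, c ∈ Set.Icc (0 : ℝ) 1 → _ :=
    fun hc => (translate_correct (F := F) (i := i) h _ (hm hc)).2
  have h01 : (0 : ℝ) ∈ Set.Icc (0 : ℝ) 1 := by simp
  -- It does not matter who makes the auxiliary cut, nor where.
  by_cases hi : 0 = i
  · simp only [GCC.game, convert, GCC.gameFrom, Game.Wins, if_pos hi]
    constructor
    · exact fun hw => ⟨⟨0, 0, h01⟩, (key h01).2 hw⟩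
    · rintro ⟨⟨j, c, hc⟩, hw⟩
      have hj : j = 0 := Fin.fin_one_eq_zero j
      subst hj
      exact (key hc).1 hw
  · simp only [GCC.game, convert, GCC.gameFrom, Game.Wins, if_neg hi]
    constructor
    · rintro hw ⟨j, c, hc⟩
      have hj : j = 0 := Fin.fin_one_eq_zero j
      subst hj
      exact (key hc).2 hw
    · exact fun hw => (key h01).1 (hw ⟨0, 0, h01⟩)

/-! ### A Turing machine for the translation -/

namespace Translator

/-- The stacks of the machine.
* `main` holds the rest of the input, and the output in the end.
* `rev` holds the output produced so far, its last token on top.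
* `agents` holds the agents of the open choose nodes, the innermost one on top. Each is stored as
  an end mark with the binary digits above it, the most significant one on top.
* `aux` holds binary digits while an agent is read from `agents`. -/
inductive Stack
  | main
  | rev
  | agents
  | aux
  deriving DecidableEq

instance : Fintype Stack :=
  ⟨{.main, .rev, .agents, .aux}, fun k => by cases k <;> decide⟩

/-- What follows a number or a point that has been copied within a cut node (`inCut = true`) or an
entry of a leaf (`inCut = false`): the left or the right end point of an interval, the end of this
interval, or, after the name of a cut, the next node. -/
inductive Next
  | lo (inCut : Bool)
  | hi (inCut : Bool)
  | close (inCut : Bool)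
  | node
  deriving DecidableEq, Fintype

/-- The labels of the machine.
* `start` writes the beginning of the output; `node` is the main loop, which reads a token that does
  not belong to a number or a point.
* `number r`, `point r`: copy a number or a point (which is renamed) to the output, then `next r`.
* `next r`: write what stands at the place described by `r`, then proceed.
* `store`: move an agent from the input to `agents`.
* `fetch`, `put`: copy the agent on top of `agents` to the output, using `aux`.
* `drop`: remove the agent on top of `agents`.
* `finish`: reverse the output. -/
inductive Label
  | start
  | node
  | number (r : Next)
  | point (r : Next)
  | next (r : Next)
  | store
  | fetch
  | put
  | drop
  | finish
  deriving DecidableEq, Fintype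

/-- The statements of the machine, whose internal state is the token popped most recently. -/
abbrev Stmt := Turing.TM2.Stmt (fun _ : Stack => Token) Label (Option Token)

/-- The configurations of the machine. -/
abbrev Cfg := Turing.TM2.Cfg (fun _ : Stack => Token) Label (Option Token)

open Turing.TM2.Stmt

/-- Appends tokens to the output. -/
def emit (l : List Token) (s : Stmt) : Stmt := l.foldr (fun t s => push .rev (fun _ => t) s) s

/-- Moves the top of the stack `k` to the internal state. -/
def take (k : Stack) (s : Stmt) : Stmt := pop k (fun _ o => o) s

/-- Pushes the internal state, which is supposed to be a token, on the stack `k`. -/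
def give (k : Stack) (s : Stmt) : Stmt := push k (fun o => o.getD .done) s

/-- Continues with the label `l`. -/
def jump (l : Label) : Stmt := goto fun _ => l

/-- The part before the agent in what a token `more` is replaced by. -/
def moreOpen : List Token := [.last, .cut]

/-- The part from the end of the agent on in what a token `more` is replaced by: the halves, the
name `0` of the auxiliary cut, and the condition that the left half was picked. -/
def moreClose : List Token :=
  .endNum :: (GCC.encodePieces halves ++ (encodeNum 0 ++ .more :: (Cond.picked 0 0).encode))

/-- The tokens at the beginning of the output, for the first auxiliary cut. -/
def opening : List Token :=
  .cut :: (encodeNum 0 ++ (GCC.encodePieces [(.left, .right)] ++ encodeNum 0))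

/-- The statement for every label. If the main loop finds the input empty, the output is complete.
In `put`, an empty stack `aux` means that all digits of the agent have been copied. -/
def program : Label → Stmt
  | .start => emit opening (jump .node)
  | .node => take .main <|
      branch (· == some .cut) (emit [.cut] (jump (.number (.lo true)))) <|
      branch (· == some .choose) (push .agents (fun _ => .endNum) (jump .store)) <|
      branch (· == some .more) (emit moreOpen (jump .fetch)) <|
      branch (· == some .last) (emit [.last] (jump .drop)) <|
      branch (· == some .piece) (emit [.choose] (jump (.number (.lo false)))) <|
      branch (· == some .done) (emit [.done] (jump .node)) <|
      jump .finish
  | .number r => take .main <| give .rev <|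
      branch (· == some .endNum) (jump (.next r)) (jump (.number r))
  | .point r => take .main <| give .rev <|
      branch (· == some .name) (emit [.bit true] (jump (.number r))) (jump (.next r))
  | .next (.lo b) => emit [.piece] (jump (.point (.hi b)))
  | .next (.hi b) => jump (.point (.close b))
  | .next (.close true) => emit [.endPieces, .bit true] (jump (.number .node))
  | .next (.close false) => emit [.endPieces] (jump .node)
  | .next .node => jump .node
  | .store => take .main <|
      branch (· == some .endNum) (jump .node) (give .agents (jump .store))
  | .fetch => take .agents <|
      branch (· == some .endNum) (give .agents (jump .put)) (give .aux (jump .fetch))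
  | .put => take .aux <|
      branch (· == none) (emit moreClose (jump .node)) (give .rev (give .agents (jump .put)))
  | .drop => take .agents <| branch (· == some .endNum) (jump .node) (jump .drop)
  | .finish => take .rev <| branch (· == none) halt (give .main (jump .finish))

/-- The machine, with the same stack for input and output. -/
def machine : Turing.FinTM2 where
  K := Stack
  k₀ := .main
  k₁ := .main
  Γ _ := Token
  Λ := Label
  main := .start
  σ := Option Token
  initialState := none
  m := program

/-- The contents of the stacks, given one by one. -/
def contents (a b c d : List Token) : Stack → List Token
  | .main => a
  | .rev => b
  | .agents => c
  | .aux => d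

section contents

variable (a b c d x : List Token)

@[simp] theorem update_main : Function.update (contents a b c d) .main x = contents x b c d := by
  funext k; cases k <;> rfl

@[simp] theorem update_rev : Function.update (contents a b c d) .rev x = contents a x c d := by
  funext k; cases k <;> rfl

@[simp] theorem update_agents :
    Function.update (contents a b c d) .agents x = contents a b x d := by
  funext k; cases k <;> rfl

@[simp] theorem update_aux : Function.update (contents a b c d) .aux x = contents a b c x := by
  funext k; cases k <;> rfl

@[simp] theorem contents_main : contents a b c d .main = a := rfl

@[simp] theorem contents_rev : contents a b c d .rev = b := rfl

@[simp] theorem contents_agents : contents a b c d .agents = c := rfl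

@[simp] theorem contents_aux : contents a b c d .aux = d := rfl

theorem stepAux_emit (l : List Token) (s : Stmt) (v : Option Token) :
    Turing.TM2.stepAux (emit l s) v (contents a b c d) =
      Turing.TM2.stepAux s v (contents a (l.reverse ++ b) c d) := by
  induction l generalizing b with
  | nil => rfl
  | cons t l ih =>
    change Turing.TM2.stepAux (emit l s) v (Function.update (contents a b c d) .rev (t :: b)) = _
    rw [update_rev, ih]
    simp

end contents

/-! ### Runs of the machine -/

/-- A configuration up to its internal state, which matters only within a step. -/
structure Position where
  label : Label
  main : List Token
  rev : List Token
  agents : List Token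
  aux : List Token

/-- The configuration with the internal state `v`. -/
def Position.cfg (p : Position) (v : Option Token) : Cfg :=
  ⟨some p.label, v, contents p.main p.rev p.agents p.aux⟩

/-- From the position `p`, the machine reaches `p'` in at most `m` steps. -/
def Runs (m : ℕ) (p p' : Position) : Prop :=
  ∀ v, ∃ v', ∃ s ≤ m, (flip bind (Turing.TM2.step program))^[s] (some (p.cfg v)) = some (p'.cfg v')

theorem Runs.refl (p : Position) : Runs 0 p p := fun v => ⟨v, 0, le_rfl, rfl⟩

theorem Runs.trans {m m' : ℕ} {p p' p'' : Position} (h : Runs m p p') (h' : Runs m' p' p'') :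
    Runs (m + m') p p'' := by
  intro v
  obtain ⟨v', s, hs, e⟩ := h v
  obtain ⟨v'', s', hs', e'⟩ := h' v'
  exact ⟨v'', s' + s, by omega, by rw [Function.iterate_add_apply, e, e']⟩

theorem Runs.mono {m m' : ℕ} {p p' : Position} (h : Runs m p p') (hm : m ≤ m') : Runs m' p p' := by
  intro v
  obtain ⟨v', s, hs, e⟩ := h v
  exact ⟨v', s, hs.trans hm, e⟩

theorem Runs.single {p p' : Position}
    (h : ∀ v, ∃ v', Turing.TM2.stepAux (program p.label) v
      (contents p.main p.rev p.agents p.aux) = p'.cfg v') : Runs 1 p p' := by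
  intro v
  obtain ⟨v', e⟩ := h v
  exact ⟨v', 1, le_rfl, congrArg some e⟩

variable {a b c d : List Token}

theorem runs_start : Runs 1 ⟨.start, a, b, c, d⟩ ⟨.node, a, opening.reverse ++ b, c, d⟩ :=
  .single fun v => ⟨v, by simp [program, stepAux_emit, jump, Position.cfg]⟩

theorem runs_cut : Runs 1 ⟨.node, .cut :: a, b, c, d⟩ ⟨.number (.lo true), a, .cut :: b, c, d⟩ :=
  .single fun _ => ⟨_, by simp [program, take, stepAux_emit, jump, Position.cfg]; rfl⟩

theorem runs_choose : Runs 1 ⟨.node, .choose :: a, b, c, d⟩ ⟨.store, a, b, .endNum :: c, d⟩ :=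
  .single fun _ => ⟨_, by simp [program, take, stepAux_emit, jump, Position.cfg]; rfl⟩

theorem runs_node_more :
    Runs 1 ⟨.node, .more :: a, b, c, d⟩ ⟨.fetch, a, moreOpen.reverse ++ b, c, d⟩ :=
  .single fun _ => ⟨_, by simp [program, take, stepAux_emit, jump, Position.cfg]; rfl⟩

theorem runs_node_last : Runs 1 ⟨.node, .last :: a, b, c, d⟩ ⟨.drop, a, .last :: b, c, d⟩ :=
  .single fun _ => ⟨_, by simp [program, take, stepAux_emit, jump, Position.cfg]; rfl⟩

theorem runs_piece :
    Runs 1 ⟨.node, .piece :: a, b, c, d⟩ ⟨.number (.lo false), a, .choose :: b, c, d⟩ :=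
  .single fun _ => ⟨_, by simp [program, take, stepAux_emit, jump, Position.cfg]; rfl⟩

theorem runs_done : Runs 1 ⟨.node, .done :: a, b, c, d⟩ ⟨.node, a, .done :: b, c, d⟩ :=
  .single fun _ => ⟨_, by simp [program, take, stepAux_emit, jump, Position.cfg]; rfl⟩

theorem runs_end : Runs 1 ⟨.node, [], b, c, d⟩ ⟨.finish, [], b, c, d⟩ :=
  .single fun _ => ⟨_, by simp [program, take, stepAux_emit, jump, Position.cfg]; rfl⟩

theorem runs_lo {i : Bool} :
    Runs 1 ⟨.next (.lo i), a, b, c, d⟩ ⟨.point (.hi i), a, .piece :: b, c, d⟩ :=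
  .single fun v => ⟨v, by simp [program, stepAux_emit, jump, Position.cfg]⟩

theorem runs_hi {i : Bool} :
    Runs 1 ⟨.next (.hi i), a, b, c, d⟩ ⟨.point (.close i), a, b, c, d⟩ :=
  .single fun v => ⟨v, by simp [program, jump, Position.cfg]⟩

theorem runs_close_cut : Runs 1 ⟨.next (.close true), a, b, c, d⟩
    ⟨.number .node, a, .bit true :: .endPieces :: b, c, d⟩ :=
  .single fun v => ⟨v, by simp [program, stepAux_emit, jump, Position.cfg]⟩

theorem runs_close_entry :
    Runs 1 ⟨.next (.close false), a, b, c, d⟩ ⟨.node, a, .endPieces :: b, c, d⟩ :=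
  .single fun v => ⟨v, by simp [program, stepAux_emit, jump, Position.cfg]⟩

theorem runs_next_node : Runs 1 ⟨.next .node, a, b, c, d⟩ ⟨.node, a, b, c, d⟩ :=
  .single fun v => ⟨v, by simp [program, jump, Position.cfg]⟩

theorem runs_number_bits (r : Next) (l : List Bool) : Runs (l.length + 1)
    ⟨.number r, l.map .bit ++ .endNum :: a, b, c, d⟩
    ⟨.next r, a, (l.map Token.bit ++ [Token.endNum]).reverse ++ b, c, d⟩ := by
  induction l generalizing b with
  | nil => exact .single fun _ => ⟨_, by simp [program, take, give, jump, Position.cfg]; rfl⟩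
  | cons t l ih =>
    have h : Runs 1 ⟨.number r, .bit t :: (l.map .bit ++ .endNum :: a), b, c, d⟩
        ⟨.number r, l.map .bit ++ .endNum :: a, .bit t :: b, c, d⟩ :=
      .single fun _ => ⟨_, by simp [program, take, give, jump, Position.cfg]; rfl⟩
    refine cast ?_ ((h.trans ih).mono (m' := (t :: l).length + 1) (by simp; omega))
    simp

theorem runs_number (r : Next) (m : ℕ) : Runs (encodeNum m).length
    ⟨.number r, encodeNum m ++ a, b, c, d⟩ ⟨.next r, a, (encodeNum m).reverse ++ b, c, d⟩ := by
  refine cast ?_ (runs_number_bits (a := a) (b := b) (c := c) (d := d) r m.bits)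
  simp [encodeNum]

/-- The renaming of cuts can be carried out while reading: it puts one digit in front. -/
theorem encodeNum_rename (z : ℕ) : encodeNum (2 * z + 1) = .bit true :: encodeNum z := by
  simp [encodeNum]

theorem runs_point (r : Next) (x : Point) : Runs x.encode.length
    ⟨.point r, x.encode ++ a, b, c, d⟩ ⟨.next r, a, x.rename.encode.reverse ++ b, c, d⟩ := by
  cases x with
  | left => exact .single fun _ => ⟨_, by
      simp [program, take, give, jump, Position.cfg, Point.encode, Point.rename]; rfl⟩
  | right => exact .single fun _ => ⟨_, by
      simp [program, take, give, jump, Position.cfg, Point.encode, Point.rename]; rfl⟩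
  | cut z =>
    have h : Runs 1 ⟨.point r, .name :: (encodeNum z ++ a), b, c, d⟩
        ⟨.number r, encodeNum z ++ a, .bit true :: .name :: b, c, d⟩ :=
      .single fun _ => ⟨_, by
        simp [program, take, give, stepAux_emit, jump, Position.cfg]; rfl⟩
    refine cast ?_ ((h.trans (runs_number r z)).mono (m' := (Point.cut z).encode.length)
      (by simp [Point.encode]; omega))
    simp [Point.encode, Point.rename, encodeNum_rename]

/-- How an agent is stored on the stack `agents`. -/
def stored (i : ℕ) : List Token := (i.bits.map .bit).reverse ++ [.endNum]

theorem runs_store_bits (l : List Bool) : Runs (l.length + 1)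
    ⟨.store, l.map .bit ++ .endNum :: a, b, c, d⟩
    ⟨.node, a, b, (l.map .bit).reverse ++ c, d⟩ := by
  induction l generalizing c with
  | nil => exact .single fun _ => ⟨_, by simp [program, take, jump, Position.cfg]; rfl⟩
  | cons t l ih =>
    have h : Runs 1 ⟨.store, .bit t :: (l.map .bit ++ .endNum :: a), b, c, d⟩
        ⟨.store, l.map .bit ++ .endNum :: a, b, .bit t :: c, d⟩ :=
      .single fun _ => ⟨_, by simp [program, take, give, jump, Position.cfg]; rfl⟩
    refine cast ?_ ((h.trans ih).mono (m' := (t :: l).length + 1) (by simp; omega))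
    simp

theorem runs_store (i : ℕ) : Runs ((encodeNum i).length + 1)
    ⟨.node, .choose :: (encodeNum i ++ a), b, c, d⟩ ⟨.node, a, b, stored i ++ c, d⟩ := by
  refine cast ?_ ((runs_choose.trans (runs_store_bits (a := a) (b := b) (c := .endNum :: c)
    (d := d) i.bits)).mono (m' := (encodeNum i).length + 1) (by simp [encodeNum]; omega))
  simp [encodeNum, stored]

theorem runs_fetch_bits (l : List Bool) : Runs (l.length + 1)
    ⟨.fetch, a, b, l.map .bit ++ .endNum :: c, d⟩
    ⟨.put, a, b, .endNum :: c, (l.map .bit).reverse ++ d⟩ := by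
  induction l generalizing d with
  | nil => exact .single fun _ => ⟨_, by simp [program, take, give, jump, Position.cfg]; rfl⟩
  | cons t l ih =>
    have h : Runs 1 ⟨.fetch, a, b, .bit t :: (l.map .bit ++ .endNum :: c), d⟩
        ⟨.fetch, a, b, l.map .bit ++ .endNum :: c, .bit t :: d⟩ :=
      .single fun _ => ⟨_, by simp [program, take, give, jump, Position.cfg]; rfl⟩
    refine cast ?_ ((h.trans ih).mono (m' := (t :: l).length + 1) (by simp; omega))
    simp

theorem runs_put_bits (l : List Bool) : Runs (l.length + 1)
    ⟨.put, a, b, c, l.map .bit⟩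
    ⟨.node, a, moreClose.reverse ++ ((l.map .bit).reverse ++ b),
      (l.map .bit).reverse ++ c, []⟩ := by
  induction l generalizing b c with
  | nil => exact .single fun _ => ⟨_, by
      simp [program, take, stepAux_emit, jump, Position.cfg]; rfl⟩
  | cons t l ih =>
    have h : Runs 1 ⟨.put, a, b, c, .bit t :: l.map .bit⟩
        ⟨.put, a, .bit t :: b, .bit t :: c, l.map .bit⟩ :=
      .single fun _ => ⟨_, by simp [program, take, give, jump, Position.cfg]; rfl⟩
    refine cast ?_ ((h.trans ih).mono (m' := (t :: l).length + 1) (by simp; omega))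
    simp

/-- What a token `more` of a choose node of agent `i` is replaced by. -/
def moreString (i : ℕ) : List Token := moreOpen ++ (i.bits.map .bit ++ moreClose)

theorem runs_more (i : ℕ) : Runs (2 * (encodeNum i).length + 1)
    ⟨.node, .more :: a, b, stored i ++ c, []⟩
    ⟨.node, a, (moreString i).reverse ++ b, stored i ++ c, []⟩ := by
  have h₁ := runs_fetch_bits (a := a) (b := moreOpen.reverse ++ b) (c := c) (d := [])
    i.bits.reverse
  have h₂ := runs_put_bits (a := a) (b := moreOpen.reverse ++ b) (c := .endNum :: c) i.bits
  simp only [List.map_reverse, List.reverse_reverse, List.append_nil] at h₁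
  have e : stored i ++ c = (i.bits.map .bit).reverse ++ .endNum :: c := by simp [stored]
  refine cast ?_ (((runs_node_more.trans h₁).trans h₂).mono
    (m' := 2 * (encodeNum i).length + 1) (by simp [encodeNum]; omega))
  simp [moreString, e]

theorem runs_drop_bits (l : List Bool) : Runs (l.length + 1)
    ⟨.drop, a, b, l.map .bit ++ .endNum :: c, d⟩ ⟨.node, a, b, c, d⟩ := by
  induction l with
  | nil => exact .single fun _ => ⟨_, by simp [program, take, jump, Position.cfg]; rfl⟩
  | cons t l ih =>
    have h : Runs 1 ⟨.drop, a, b, .bit t :: (l.map .bit ++ .endNum :: c), d⟩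
        ⟨.drop, a, b, l.map .bit ++ .endNum :: c, d⟩ :=
      .single fun _ => ⟨_, by simp [program, take, jump, Position.cfg]; rfl⟩
    exact (h.trans ih).mono (by simp; omega)

theorem runs_last (i : ℕ) : Runs ((encodeNum i).length + 1)
    ⟨.node, .last :: a, b, stored i ++ c, d⟩ ⟨.node, a, .last :: b, c, d⟩ := by
  have h := runs_drop_bits (a := a) (b := .last :: b) (c := c) (d := d) i.bits.reverse
  have e : stored i ++ c = i.bits.reverse.map .bit ++ .endNum :: c := by simp [stored]
  rw [e]
  exact (runs_node_last.trans h).mono (by simp [encodeNum]; omega)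

/-- With `s` on top of the input and `s'` to be appended to the output, the main loop of the machine
needs at most `m` steps for the part `s` of the input. The bound on the length of `s'` is for the
time needed to reverse the output in the end. -/
structure Processes (m : ℕ) (s s' : List Token) : Prop where
  runs : ∀ a b c, Runs m ⟨.node, s ++ a, b, c, []⟩ ⟨.node, a, s'.reverse ++ b, c, []⟩
  length_le : s'.length ≤ m

theorem length_encode_rename_le (x : Point) : x.rename.encode.length ≤ x.encode.length + 1 := by
  cases x <;> simp [Point.rename, Point.encode, encodeNum_rename]

theorem processes_leaf (A : List (ℕ × Point × Point)) :
    Processes (5 * (ExtBC.leaf A).encode.length) (ExtBC.leaf A).encode (allot A).encode := by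
  induction A with
  | nil => exact ⟨fun a b c => runs_done.mono (by simp [ExtBC.encode]),
      by simp [ExtBC.encode, allot, GCC.encode]⟩
  | cons p A ih =>
    obtain ⟨i, x, y⟩ := p
    have e : (ExtBC.leaf ((i, x, y) :: A)).encode =
        .piece :: (encodeNum i ++ (x.encode ++ (y.encode ++ (ExtBC.leaf A).encode))) := by
      simp [ExtBC.encode]
    have e' : (allot ((i, x, y) :: A)).encode = .choose :: (encodeNum i ++ (.piece ::
        (x.rename.encode ++ (y.rename.encode ++ (.endPieces :: (allot A).encode))))) := by
      simp [allot, GCC.encode, GCC.encodePieces]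
    rw [e, e']
    constructor
    · intro a b c
      have h := (((((runs_piece.trans (runs_number _ i)).trans runs_lo).trans
        (runs_point _ x)).trans runs_hi).trans (runs_point _ y)).trans runs_close_entry |>.trans
        (ih.runs a (.endPieces :: (y.rename.encode.reverse ++ (x.rename.encode.reverse ++ .piece ::
          ((encodeNum i).reverse ++ .choose :: b)))) c)
      refine cast ?_ (h.mono (m' := 5 * (Token.piece :: (encodeNum i ++ (x.encode ++
        (y.encode ++ (ExtBC.leaf A).encode)))).length) (by simp; omega))
      simp
    · have h := ih.length_le
      have hx := length_encode_rename_le x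
      have hy := length_encode_rename_le y
      simp only [List.length_cons, List.length_append]
      omega

/-- The part of the string for a choose node that lists the children. -/
def encodeChildren (k : ℕ) (t : Fin (k + 1) → ExtBC) : List Token :=
  (List.ofFn fun j : Fin k => .more :: (t j.castSucc).encode).flatten ++
    .last :: (t (Fin.last k)).encode

theorem encodeChildren_succ (k : ℕ) (t : Fin (k + 2) → ExtBC) :
    encodeChildren (k + 1) t = .more :: ((t 0).encode ++ encodeChildren k fun j => t j.succ) := by
  simp [encodeChildren, List.ofFn_succ]

theorem encode_menu_succ (i k : ℕ) (t : Fin (k + 2) → GCC) :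
    Token.last :: (menu i (k + 1) t).encode =
      moreString i ++ ((t 0).encode ++ .last :: (menu i k fun j => t j.succ).encode) := by
  simp [menu, GCC.encode, moreString, moreOpen, moreClose, encodeNum]

/-- While the children of a choose node are processed, the agent of this node remains stored on the
stack until the token `last` is met. -/
theorem runs_children {i B : ℕ} (hB : 2 * (encodeNum i).length + 17 ≤ B) (k : ℕ) :
    ∀ t : Fin (k + 1) → ExtBC,
      (∀ j, Processes (B * (t j).encode.length) (t j).encode (translate (t j)).encode) →
      (∀ a b c, Runs (B * (encodeChildren k t).length)
        ⟨.node, encodeChildren k t ++ a, b, stored i ++ c, []⟩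
        ⟨.node, a, (.last :: (menu i k fun j => translate (t j)).encode).reverse ++ b, c, []⟩) ∧
      (.last :: (menu i k fun j => translate (t j)).encode).length ≤
        B * (encodeChildren k t).length := by
  induction k with
  | zero =>
    intro t ht
    have e : encodeChildren 0 t = .last :: (t 0).encode := by simp [encodeChildren]
    rw [e]
    have hl : B * (Token.last :: (t 0).encode).length = B * (t 0).encode.length + B := by
      rw [List.length_cons, Nat.mul_succ]
    rw [hl]
    constructor
    · intro a b c
      refine cast ?_ (((runs_last i).trans ((ht 0).runs a (.last :: b) c)).mono
        (m' := B * (t 0).encode.length + B) (by omega))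
      simp [menu]
    · have := (ht 0).length_le
      simp only [menu, List.length_cons]
      omega
  | succ k ih =>
    intro t ht
    obtain ⟨h₁, h₂⟩ := ih (fun j => t j.succ) fun j => ht j.succ
    rw [encodeChildren_succ, encode_menu_succ]
    have hl : B * (Token.more :: ((t 0).encode ++ encodeChildren k fun j => t j.succ)).length =
        B * (t 0).encode.length + B * (encodeChildren k fun j => t j.succ).length + B := by
      rw [List.length_cons, List.length_append]; ring
    rw [hl]
    constructor
    · intro a b c
      have h := ((runs_more i).trans ((ht 0).runs ((encodeChildren k fun j => t j.succ) ++ a)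
        ((moreString i).reverse ++ b) (stored i ++ c))).trans (h₁ a
        ((translate (t 0)).encode.reverse ++ ((moreString i).reverse ++ b)) c)
      refine cast ?_ (h.mono (m' := B * (t 0).encode.length +
        B * (encodeChildren k fun j => t j.succ).length + B) (by omega))
      simp
    · have h₀ := (ht 0).length_le
      have hm : (moreString i).length = (encodeNum i).length + 16 := by
        simp [moreString, moreOpen, moreClose, encodeNum, halves, GCC.encodePieces, Point.encode,
          Cond.encode]
      rw [List.length_append, List.length_append, hm]
      omega

/-- On average, a token of the input takes at most `2 * N + 17` steps, which is enough to read an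
agent from the stack and to store it again. -/
theorem processes_encode {N : ℕ} (P : ExtBC) (hN : P.encode.length ≤ N) :
    Processes ((2 * N + 17) * P.encode.length) P.encode (translate P).encode := by
  induction P with
  | cut i x y z t ih =>
    simp only [ExtBC.encode, List.length_cons, List.length_append] at hN
    have ih := ih (by omega)
    have e : (translate (.cut i x y z t)).encode = .cut :: (encodeNum i ++ (.piece ::
        (x.rename.encode ++ (y.rename.encode ++ (.endPieces :: (.bit true :: (encodeNum z ++
          (translate t).encode))))))) := by
      simp [translate, GCC.encode, GCC.encodePieces, encodeNum_rename]
    -- The token `cut` pays for the constant part, and the tokens of `i`, `x`, `y` and `z` for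
    -- themselves.
    have hl : (2 * N + 17) * t.encode.length + 17 + ((encodeNum i).length + x.encode.length +
        y.encode.length + (encodeNum z).length) ≤
        (2 * N + 17) * (ExtBC.cut i x y z t).encode.length := by
      simp only [ExtBC.encode, List.length_cons, List.length_append]
      nlinarith
    refine ⟨fun a b c => ?_, ?_⟩
    · have h := ((((((((runs_cut.trans (runs_number _ i)).trans runs_lo).trans
        (runs_point _ x)).trans runs_hi).trans (runs_point _ y)).trans runs_close_cut).trans
        (runs_number _ z)).trans runs_next_node).trans
        (ih.runs a ((encodeNum z).reverse ++ .bit true :: .endPieces :: (y.rename.encode.reverse ++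
          (x.rename.encode.reverse ++ .piece :: ((encodeNum i).reverse ++ .cut :: b)))) c)
      refine cast ?_ (h.mono (m' := (2 * N + 17) * (ExtBC.cut i x y z t).encode.length) (by omega))
      rw [e]
      simp [ExtBC.encode]
    · have h := ih.length_le
      have hx := length_encode_rename_le x
      have hy := length_encode_rename_le y
      rw [e]
      simp only [List.length_cons, List.length_append]
      omega
  | choose i k t ih =>
    have e : (ExtBC.choose i k t).encode = .choose :: (encodeNum i ++ encodeChildren k t) := rfl
    have e' : (translate (.choose i k t)).encode =
        .last :: (menu i k fun j => translate (t j)).encode := by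
      simp [translate, GCC.encode]
    rw [e, List.length_cons, List.length_append] at hN
    have hj : ∀ j, (t j).encode.length ≤ (encodeChildren k t).length := by
      intro j
      refine Fin.lastCases ?_ (fun j => ?_) j
      · simp [encodeChildren]; omega
      · have hmem : Token.more :: (t j.castSucc).encode ∈
            List.ofFn fun j : Fin k => Token.more :: (t j.castSucc).encode :=
          List.mem_ofFn.2 ⟨j, rfl⟩
        have := (List.sublist_flatten_of_mem hmem).length_le
        simp only [List.length_cons] at this
        simp only [encodeChildren, List.length_append]
        omega
    obtain ⟨h₁, h₂⟩ := runs_children (i := i) (B := 2 * N + 17) (by omega) k t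
      fun j => ih j ((hj j).trans (by omega))
    rw [e, e']
    have hl : (2 * N + 17) * (encodeChildren k t).length + ((encodeNum i).length + 1) ≤
        (2 * N + 17) * (Token.choose :: (encodeNum i ++ encodeChildren k t)).length := by
      simp only [List.length_cons, List.length_append]
      nlinarith
    refine ⟨fun a b c => ?_, h₂.trans (by omega)⟩
    refine cast ?_ (((runs_store i).trans (h₁ a b c)).mono
      (m' := (2 * N + 17) * (Token.choose :: (encodeNum i ++ encodeChildren k t)).length)
      (by omega))
    simp
  | leaf A =>
    have h := processes_leaf A
    have hl : 5 * (ExtBC.leaf A).encode.length ≤ (2 * N + 17) * (ExtBC.leaf A).encode.length :=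
      Nat.mul_le_mul_right _ (by omega)
    exact ⟨fun a b c => (h.runs a b c).mono hl, h.length_le.trans hl⟩

theorem runs_finish (l a : List Token) :
    Runs l.length ⟨.finish, a, l, [], []⟩ ⟨.finish, l.reverse ++ a, [], [], []⟩ := by
  induction l generalizing a with
  | nil => exact .refl _
  | cons t l ih =>
    have h : Runs 1 ⟨.finish, a, t :: l, [], []⟩ ⟨.finish, t :: a, l, [], []⟩ :=
      .single fun _ => ⟨_, by simp [program, take, give, jump, Position.cfg]; rfl⟩
    refine cast ?_ ((h.trans (ih (t :: a))).mono (m' := (t :: l).length) (by simp; omega))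
    simp

theorem initList_machine (s : List Token) :
    Turing.initList machine s = (Position.mk .start s [] [] []).cfg none := by
  unfold Turing.initList Position.cfg
  congr 1
  funext k
  cases k <;> rfl

theorem haltList_machine (s : List Token) :
    Turing.haltList machine s = (⟨none, none, contents s [] [] []⟩ : Cfg) := by
  unfold Turing.haltList
  congr 1
  funext k
  cases k <;> rfl

theorem machine_outputs (P : ExtBC) :
    ∃ s ≤ 2 * ((2 * P.encode.length + 17) * P.encode.length) + 10,
      (flip bind machine.step)^[s] (some (Turing.initList machine P.encode)) =
        some (Turing.haltList machine (convert P).encode) := by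
  have h := processes_encode P le_rfl
  have e : (convert P).encode = opening ++ (translate P).encode := by
    simp [convert, GCC.encode, opening]
  have ho : opening.length = 7 := by
    simp [opening, encodeNum, GCC.encodePieces, Point.encode]
  have hr := (((runs_start (a := P.encode ++ []) (b := []) (c := []) (d := [])).trans
    (h.runs [] _ [])).trans runs_end).trans (runs_finish _ [])
  obtain ⟨v, s, hs, hsv⟩ := hr none
  -- The last step halts, as the stack `rev` is empty.
  refine ⟨1 + s, ?_, ?_⟩
  · have := h.length_le
    simp only [List.length_append, List.length_reverse, ho, List.length_nil] at hs
    omega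
  · rw [List.append_nil, ← initList_machine] at hsv
    rw [Function.iterate_add_apply]
    refine (congrArg _ hsv).trans ?_
    rw [haltList_machine, e]
    refine congrArg some ?_
    change Turing.TM2.stepAux (program .finish) v _ = _
    simp [program, take]

/-- The translation is computed in quadratic time. -/
noncomputable def convertPolyTime :
    Turing.TM2ComputableInPolyTime ExtBC.encoding.encode GCC.encoding.encode convert where
  tm := machine
  inputAlphabet := Equiv.refl _
  outputAlphabet := Equiv.refl _
  time := 2 * ((2 * .X + 17) * .X) + 10
  outputsFun P :=
    have h := machine_outputs P
    { steps := h.choose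
      evals_in_steps :=
        ((congrArg (fun l => (flip bind machine.step)^[h.choose]
          (some (Turing.initList machine l))) (List.map_id P.encode)).trans
            h.choose_spec.2).trans
              (congrArg (fun l => some (Turing.haltList machine l)) (List.map_id _).symm)
      steps_le_m := by
        simpa [ExtBC.encoding] using h.choose_spec.1 }

end Translator

end CakeCutting

theorem mainTheorem8 :
    ∃ f : CakeCutting.ExtBC → CakeCutting.GCC,
      Nonempty (Turing.TM2ComputableInPolyTime CakeCutting.ExtBC.encoding.encode
        CakeCutting.GCC.encoding.encode f) ∧
      ∀ (n : ℕ) (P : CakeCutting.ExtBC), P.Valid n →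
        (f P).Valid n ∧ CakeCutting.StronglyEnvyEquivalent n P.game (f P).game :=
  ⟨CakeCutting.convert, ⟨CakeCutting.Translator.convertPolyTime⟩,
    fun _ _ h => CakeCutting.convert_correct h⟩
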